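/- Let $m\ge 1$ be an integer, $\lambda_2>\lambda_1>0$, and let $A,B,C\in\mathbb C$ satisfy $$|B|>|C|,\qquad m^2|A|^2<2\Big(\frac{\lambda_2}{\lambda_1}-1\Big)|C|^2 .$$ Let $N_1\ge 1$, $N_2\ge 0$, let $p_{1,1},\dots,p_{1,N_1}$ and $p_{2,1},\dots,p_{2,N_2}$ be points (not necessarily distinct) such that each point occurs among the $p_{2,s}$ at most as often as among the $p_{1,s}$, and let $(u_1,u_2)$ be a solution of $$\Delta u_1=\lambda_1\Big(m|A|^2[e^{mu_1}-1]+|B|^2[e^{u_1+u_2}-1]+|C|^2[e^{u_1-u_2}-1]\Big)+4\pi\sum_{s=1}^{N_1}\delta_{p_{1,s}},$$ $$\Delta u_2=\lambda_2\Big(|B|^2[e^{u_1+u_2}-1]-|C|^2[e^{u_1-u_2}-1]\Big)+4\pi\sum_{s=1}^{N_2}\delta_{p_{2,s}},$$ which is either * planar: the equations hold on $\mathbb R^2$ and $u_1(x),u_2(x)\to0$ as $|x|\to\infty$; or * doubly periodic: the equations hold on a flat torus $\mathbb R^2/(\mathbb Z\omega_1+\mathbb Z\omega_2)$ with linearly independent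 periods $\omega_1,\omega_2\in\mathbb R^2$, points being counted modulo the lattice. Here a solution is a pair of real functions, continuous away from the vortex points $p_{j,s}$, such that $u_1$, $u_2$ and the non-singular parts of the two right-hand sides are locally integrable and the equations hold in the sense of distributions. Then, at every point that is not a vortex point, $$\frac{u_1}{\lambda_1}+\frac{u_2}{\lambda_2}<0,\qquad \frac{u_1}{\lambda_1}-\frac{u_2}{\lambda_2}<0,\qquad\text{and in particular}\quad u_1<0 .$$ -/

import Mathlib

open Filter Topology MeasureTheory

noncomputable section

namespace Vortex

/-- The Euclidean plane. -/
abbrev Plane : Type := EuclideanSpace ℝ (Fin 2)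

/-- The positions of the point vortices `p s`, together with all their translates under the group
of periods `L`. In the planar problem `L = ⊥` and there are no further translates. -/
def vortexSet (L : AddSubgroup Plane) {N : ℕ} (p : Fin N → Plane) : Set Plane :=
  {x | ∃ s, x - p s ∈ L}

/-- The multiplicity of `x` among the vortices `p s`, positions being read modulo `L`. -/
def vortexMult (L : AddSubgroup Plane) {N : ℕ} (p : Fin N → Plane) (x : Plane) : ℕ :=
  {s : Fin N | x - p s ∈ L}.ncard

/-- `u` solves `Δ u = f + 4 π ∑ₛ δ_{p s}` in the sense of distributions, the Dirac masses being
repeated at all translates under `L`: on the plane for `L = ⊥`, on the torus `ℝ² / L` when `L` is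
a lattice. For a test function `φ` and a lattice `L` the sum over `L` has finitely many non-zero
terms. -/
structure SolvesPoisson (L : AddSubgroup Plane) {N : ℕ} (p : Fin N → Plane)
    (u f : Plane → ℝ) : Prop where
  locallyIntegrable : LocallyIntegrable u
  locallyIntegrable_rhs : LocallyIntegrable f
  eq : ∀ φ : Plane → ℝ, ContDiff ℝ (⊤ : ℕ∞) φ → HasCompactSupport φ →
    (∫ x, u x * Laplacian.laplacian φ x) =
      (∫ x, f x * φ x) + 4 * Real.pi * ∑ s : Fin N, ∑' l : L, φ (p s + (l : Plane))

/-- The regular part of the right-hand side of the first master equation. -/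
def rhs₁ (m : ℕ) (lam₁ : ℝ) (A B C : ℂ) (u₁ u₂ : Plane → ℝ) (x : Plane) : ℝ :=
  lam₁ * (m * ‖A‖ ^ 2 * (Real.exp (m * u₁ x) - 1) + ‖B‖ ^ 2 * (Real.exp (u₁ x + u₂ x) - 1)
    + ‖C‖ ^ 2 * (Real.exp (u₁ x - u₂ x) - 1))

/-- The regular part of the right-hand side of the second master equation. -/
def rhs₂ (lam₂ : ℝ) (B C : ℂ) (u₁ u₂ : Plane → ℝ) (x : Plane) : ℝ :=
  lam₂ * (‖B‖ ^ 2 * (Real.exp (u₁ x + u₂ x) - 1) - ‖C‖ ^ 2 * (Real.exp (u₁ x - u₂ x) - 1))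

/-- `(u₁, u₂)` solves the system of master equations with the vortices `p₁`, `p₂` repeated along
`L`. The functions are continuous away from the vortices; their values at the vortices, where the
logarithmic singularities sit, carry no meaning. -/
structure IsSolution (L : AddSubgroup Plane) (m : ℕ) (lam₁ lam₂ : ℝ) (A B C : ℂ) {N₁ N₂ : ℕ}
    (p₁ : Fin N₁ → Plane) (p₂ : Fin N₂ → Plane) (u₁ u₂ : Plane → ℝ) : Prop where
  continuousOn₁ : ContinuousOn u₁ (vortexSet L p₁ ∪ vortexSet L p₂)ᶜ
  continuousOn₂ : ContinuousOn u₂ (vortexSet L p₁ ∪ vortexSet L p₂)ᶜ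
  eq₁ : SolvesPoisson L p₁ u₁ (rhs₁ m lam₁ A B C u₁ u₂)
  eq₂ : SolvesPoisson L p₂ u₂ (rhs₂ lam₂ B C u₁ u₂)

/-- The lattice generated by the two periods `ω 0` and `ω 1`. -/
def periodLattice (ω : Fin 2 → Plane) : AddSubgroup Plane :=
  AddSubgroup.closure (Set.range ω)

/-- A planar solution: a solution on the whole plane with `u₁, u₂ → 0` at infinity. -/
structure IsPlanarSolution (m : ℕ) (lam₁ lam₂ : ℝ) (A B C : ℂ) {N₁ N₂ : ℕ}
    (p₁ : Fin N₁ → Plane) (p₂ : Fin N₂ → Plane) (u₁ u₂ : Plane → ℝ) : Prop where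
  isSolution : IsSolution ⊥ m lam₁ lam₂ A B C p₁ p₂ u₁ u₂
  tendsto₁ : Tendsto u₁ (cocompact Plane) (𝓝 0)
  tendsto₂ : Tendsto u₂ (cocompact Plane) (𝓝 0)

/-- A doubly periodic solution with periods `ω 0` and `ω 1`, written as a periodic function on the
plane. -/
structure IsPeriodicSolution (ω : Fin 2 → Plane) (m : ℕ) (lam₁ lam₂ : ℝ) (A B C : ℂ) {N₁ N₂ : ℕ}
    (p₁ : Fin N₁ → Plane) (p₂ : Fin N₂ → Plane) (u₁ u₂ : Plane → ℝ) : Prop where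
  isSolution : IsSolution (periodLattice ω) m lam₁ lam₂ A B C p₁ p₂ u₁ u₂
  periodic₁ : ∀ l ∈ periodLattice ω, ∀ x,
    x ∉ vortexSet (periodLattice ω) p₁ ∪ vortexSet (periodLattice ω) p₂ → u₁ (x + l) = u₁ x
  periodic₂ : ∀ l ∈ periodLattice ω, ∀ x,
    x ∉ vortexSet (periodLattice ω) p₁ ∪ vortexSet (periodLattice ω) p₂ → u₂ (x + l) = u₂ x

end Vortex

end

/-!
Put `W = u₁ / λ₁ + u₂ / λ₂` and `Z = u₁ / λ₁ - u₂ / λ₂`. In `Δ W` the terms with `C` cancel and in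
`Δ Z` the terms with `B` cancel. Bounding `exp t - 1` below by `t` gives, in the sense of
distributions,
`Δ W ≥ a W + b (W - Z)` and `Δ Z ≥ a' Z + b' (Z - W)`, up to point masses,
with `a, a' > 0`. The hypothesis on `A` says exactly that `b' > 0`, and then `|B| > |C|` gives
`b > 0`, so that this linear system is cooperative. The point masses are nonnegative: those of `W`
trivially, those of `Z` because each point is at most as often a vortex of `u₂` as of `u₁` and
`λ₁ < λ₂`.

Being linear with constant coefficients, the system is inherited by mollifications, which are smooth
on the whole plane, so that no analysis at the logarithmic singularities is needed. At a positive
maximum of `max W Z` the larger function would have positive Laplacian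
(`max_nonpos_of_cooperative`); the maximum is attained because the mollified functions tend to zero
at infinity (`exists_max_of_tendsto_zero`) or are periodic (`exists_max_of_periodic`). Letting the
mollification parameter tend to zero, `W ≤ 0` and `Z ≤ 0` off the vortices.

With these signs the system decouples into `Δ W ≥ (a + b) W` and `Δ Z ≥ (a' + b') Z`, again up to
nonnegative point masses, of which the one at a vortex of `u₁` is positive for both functions.
A quantitative strong maximum principle (`exists_barrier_le`, `neg_of_weakSub`) shows that a zero of
`W` off the vortices would force `W = 0` almost everywhere, against that point mass; likewise for
`Z`. The inequality `u₁ < 0` follows by adding the other two.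
-/

noncomputable section

namespace Vortex

open Laplacian Metric

/-! ### The Laplacian and maximum principles for smooth functions -/

section Laplacian

variable {E : Type*} [NormedAddCommGroup E] [InnerProductSpace ℝ E] [FiniteDimensional ℝ E]

lemma laplacian_eq_sum_fderiv {f : E → ℝ} (hf : ContDiff ℝ 2 f) (x : E) :
    Δ f x = ∑ i, fderiv ℝ (fun y => fderiv ℝ f y (stdOrthonormalBasis ℝ E i)) x
      (stdOrthonormalBasis ℝ E i) := by
  rw [InnerProductSpace.laplacian_eq_iteratedFDeriv_stdOrthonormalBasis]
  refine Finset.sum_congr rfl fun i _ => ?_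
  have hd : DifferentiableAt ℝ (fderiv ℝ f) x :=
    ((hf.fderiv_right (m := 1) (by norm_num)).differentiable (by norm_num)) x
  rw [iteratedFDeriv_two_apply, fderiv_clm_apply hd (differentiableAt_const _)]
  simp

omit [FiniteDimensional ℝ E] in
lemma contDiff_fderiv_apply {f : E → ℝ} {n : ℕ} (hf : ContDiff ℝ (n + 1 : ℕ) f) (e : E) :
    ContDiff ℝ n (fun y => fderiv ℝ f y e) :=
  (hf.fderiv_right (m := n) (by norm_cast)).clm_apply contDiff_const

lemma continuous_laplacian {f : E → ℝ} (hf : ContDiff ℝ 2 f) : Continuous (Δ f) := by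
  rw [funext (laplacian_eq_sum_fderiv hf)]
  refine continuous_finsetSum _ fun i _ => ?_
  set e := stdOrthonormalBasis ℝ E i
  exact (contDiff_fderiv_apply (n := 0) (contDiff_fderiv_apply (n := 1) hf e) e).continuous

lemma hasCompactSupport_laplacian {f : E → ℝ} (hf : ContDiff ℝ 2 f) (hc : HasCompactSupport f) :
    HasCompactSupport (Δ f) := by
  rw [funext (laplacian_eq_sum_fderiv hf)]
  refine HasCompactSupport.intro hc fun x hx => Finset.sum_eq_zero fun i _ => ?_
  set e := stdOrthonormalBasis ℝ E i
  refine image_eq_zero_of_notMem_tsupport (f := fun x => fderiv ℝ (fun y => fderiv ℝ f y e) x e)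
    fun h => hx ?_
  exact tsupport_fderiv_apply_subset ℝ e (tsupport_fderiv_apply_subset ℝ e h)

/-- If the second derivative along a basis vector were positive, the maximum would also be a local
minimum along that line, so the function would be locally constant there. -/
lemma laplacian_nonpos_of_isLocalMax {f : E → ℝ} (hf : ContDiff ℝ 2 f) {x : E}
    (hx : IsLocalMax f x) : Δ f x ≤ 0 := by
  rw [laplacian_eq_sum_fderiv hf]
  refine Finset.sum_nonpos fun i _ => ?_
  set e := stdOrthonormalBasis ℝ E i
  by_contra! hpos
  have hline : ∀ t : ℝ, HasDerivAt (fun t : ℝ => x + t • e) e t := fun t => by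
    simpa using ((hasDerivAt_id t).smul_const e).const_add x
  set g : ℝ → ℝ := fun t => f (x + t • e) with hg
  have hg1 : deriv g = fun t => fderiv ℝ f (x + t • e) e := by
    funext t
    exact (((hf.differentiable (by norm_num)) (x + t • e)).hasFDerivAt.comp_hasDerivAt t
      (hline t)).deriv
  have hg2 : deriv (deriv g) 0 = fderiv ℝ (fun y => fderiv ℝ f y e) x e := by
    have hd : DifferentiableAt ℝ (fun y => fderiv ℝ f y e) (x + (0 : ℝ) • e) :=
      ((contDiff_fderiv_apply (n := 1) hf e).differentiable (by norm_num)) _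
    rw [hg1]
    have := (hd.hasFDerivAt.comp_hasDerivAt (0 : ℝ) (hline 0)).deriv
    simpa [Function.comp_def] using this
  have hcont : ContinuousAt (fun t : ℝ => x + t • e) 0 := (hline 0).continuousAt
  have hmax : IsLocalMax g 0 := by
    have hx' : IsLocalMax f (x + (0 : ℝ) • e) := by simpa using hx
    exact IsMaxFilter.comp_tendsto (g := fun t : ℝ => x + t • e) hx' hcont
  have hgc : ContinuousAt g 0 :=
    (hf.continuous.continuousAt).comp hcont
  have hmin : IsLocalMin g 0 :=
    isLocalMin_of_deriv_deriv_pos (by rw [hg2]; exact hpos) hmax.deriv_eq_zero hgc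
  have hconst : g =ᶠ[𝓝 0] fun _ => g 0 := by
    filter_upwards [hmax, hmin] with t h1 h2 using le_antisymm h1 h2
  have h0 : deriv (deriv g) 0 = 0 := by
    rw [hconst.deriv.deriv_eq]; simp
  rw [hg2] at h0
  exact hpos.ne' h0

lemma laplacian_nonneg_of_isLocalMin {f : E → ℝ} (hf : ContDiff ℝ 2 f) {x : E}
    (hx : IsLocalMin f x) : 0 ≤ Δ f x := by
  have h := laplacian_nonpos_of_isLocalMax hf.neg hx.neg
  have h2 : Δ (-f) x = -Δ f x := by
    rw [InnerProductSpace.laplacian_neg]; rfl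
  change Δ (-f) x ≤ 0 at h
  linarith

lemma laplacian_comp_const_sub {f : E → ℝ} (hf : ContDiff ℝ 2 f) (x y : E) :
    Δ (fun z => f (x - z)) y = Δ f (x - y) := by
  have hf' : ContDiff ℝ 2 (fun z => f (x - z)) := hf.comp (contDiff_const.sub contDiff_id)
  rw [laplacian_eq_sum_fderiv hf, laplacian_eq_sum_fderiv hf']
  refine Finset.sum_congr rfl fun i _ => ?_
  set e := stdOrthonormalBasis ℝ E i
  have h (g : E → ℝ) (hg : Differentiable ℝ g) (z : E) :
      fderiv ℝ (fun z => g (x - z)) z = -fderiv ℝ g (x - z) := by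
    have h' : HasFDerivAt (fun z => g (x - z)) _ z :=
      (hg (x - z)).hasFDerivAt.comp z ((hasFDerivAt_id z).const_sub x)
    rw [h'.fderiv]
    ext; simp
  simp only [h f (hf.differentiable (by norm_num)), neg_apply]
  have hd : Differentiable ℝ (fun z => -(fderiv ℝ f z) e) :=
    ((contDiff_fderiv_apply (n := 1) hf e).differentiable (by norm_num)).neg
  rw [h _ hd, fderiv_fun_neg]
  simp

lemma laplacian_gaussian (α : ℝ) (y x : E) :
    Δ (fun z => Real.exp (-α * ‖z - y‖ ^ 2)) x =
      (4 * α ^ 2 * ‖x - y‖ ^ 2 - 2 * α * Module.finrank ℝ E) * Real.exp (-α * ‖x - y‖ ^ 2) := by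
  set g : E → ℝ := fun z => Real.exp (-α * ‖z - y‖ ^ 2) with hg
  have hgc : ContDiff ℝ 2 g := by
    refine Real.contDiff_exp.comp (contDiff_const.mul ?_)
    exact (contDiff_id.sub contDiff_const).norm_sq ℝ
  have h1 (z e : E) : fderiv ℝ g z e = -2 * α * inner ℝ (z - y) e * g z := by
    have := (((hasFDerivAt_id z).sub_const y).norm_sq.const_mul (-α)).exp
    have h' : HasFDerivAt g _ z := this
    rw [h'.fderiv]
    simp [hg, inner_sub_left]
    ring
  rw [laplacian_eq_sum_fderiv hgc]
  have h2 (e : E) (he : ‖e‖ = 1) : fderiv ℝ (fun z => fderiv ℝ g z e) x e =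
      (4 * α ^ 2 * inner ℝ (x - y) e ^ 2 - 2 * α) * g x := by
    simp only [h1]
    have hi : HasFDerivAt (fun z : E => inner ℝ (z - y) e)
        ((innerSL ℝ e : E →L[ℝ] ℝ)) x := by
      have := (innerSL ℝ e : E →L[ℝ] ℝ).hasFDerivAt.comp x ((hasFDerivAt_id x).sub_const y)
      refine (this.congr_of_eventuallyEq (Eventually.of_forall fun z => ?_))
      simp [real_inner_comm]
    have hgd : HasFDerivAt g (fderiv ℝ g x) x := (hgc.differentiable (by norm_num) x).hasFDerivAt
    have h' : HasFDerivAt (fun z => -2 * α * inner ℝ (z - y) e * g z) _ x :=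
      (hi.const_mul (-2 * α)).mul hgd
    rw [h'.fderiv]
    simp [h1, he]
    ring
  simp_rw [fun i => h2 _ ((stdOrthonormalBasis ℝ E).norm_eq_one i), ← Finset.sum_mul,
    Finset.sum_sub_distrib, ← Finset.mul_sum, (stdOrthonormalBasis ℝ E).sum_sq_inner_left]
  simp [hg]
  ring

/-- Quantitative strong minimum principle: a nonnegative supersolution of `Δ f = c f` that is at
least `m` on a ball is bounded below on every larger ball of radius `R`, by a multiple of `m` that
does not depend on `f`. The lower bound is the Gaussian barrier used for the Hopf lemma; since it
depends on `f` only through `m`, it survives the passage to the limit in a mollification. -/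
lemma exists_barrier_le (c : ℝ) (hc : 0 < c) {r R : ℝ} (hr : 0 < r) (hR : 0 < R) :
    ∃ α : ℝ, 0 < α ∧ ∀ (f : E → ℝ) (y : E) (m : ℝ), ContDiff ℝ 2 f → (∀ x, 0 ≤ f x) →
      (∀ x, Δ f x ≤ c * f x) → 0 ≤ m → (∀ x ∈ closedBall y r, m ≤ f x) →
      ∀ x, m * (Real.exp (-α * ‖x - y‖ ^ 2) - Real.exp (-α * R ^ 2)) ≤ f x := by
  set n : ℝ := (Module.finrank ℝ E : ℝ) with hn
  have hn0 : 0 ≤ n := by positivity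
  set α : ℝ := (2 * n + c) / (4 * r ^ 2) + 1 with hα
  have hα1 : 1 ≤ α := by
    have : 0 ≤ (2 * n + c) / (4 * r ^ 2) := by positivity
    linarith
  -- the choice of `α` makes the barrier a strict subsolution outside the ball of radius `r`
  have hαr : c + 2 * α * n ≤ 4 * α ^ 2 * r ^ 2 := by
    have h1 : 2 * n + c ≤ 4 * r ^ 2 * α := by
      rw [hα, mul_add, mul_div_cancel₀ _ (by positivity)]; nlinarith [sq_nonneg r]
    nlinarith [mul_le_mul_of_nonneg_left h1 (by linarith : (0:ℝ) ≤ α)]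
  refine ⟨α, by linarith, fun f y m hf hf0 hΔ hm hball => ?_⟩
  by_contra! hcon
  obtain ⟨x, hx⟩ := hcon
  -- a negative minimum of `f - m h` over the ball of radius `R` is a global minimum
  set G : E → ℝ := fun z => Real.exp (-α * ‖z - y‖ ^ 2) with hG
  set h : E → ℝ := fun z => G z - Real.exp (-α * R ^ 2) with hh
  set g : E → ℝ := fun z => f z - m * h z with hg
  have hGc : ContDiff ℝ 2 G :=
    Real.contDiff_exp.comp (contDiff_const.mul ((contDiff_id.sub contDiff_const).norm_sq ℝ))
  have hhc : ContDiff ℝ 2 h := hGc.sub contDiff_const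
  have hgc : ContDiff ℝ 2 g := hf.sub (contDiff_const.mul hhc)
  have hout : ∀ z, z ∉ closedBall y R → 0 ≤ g z := fun z hz => by
    rw [mem_closedBall, dist_eq_norm, not_le] at hz
    have h1 : h z ≤ 0 := by
      have : G z ≤ Real.exp (-α * R ^ 2) := by
        apply Real.exp_le_exp.2
        nlinarith [pow_le_pow_left₀ hR.le hz.le 2]
      simp only [hh]; linarith
    have := hf0 z
    simp only [hg]; nlinarith
  have hgx : g x < 0 := by simp only [hg, hh, hG]; linarith
  obtain ⟨z, hz, hzmin⟩ := (isCompact_closedBall y R).exists_isMinOn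
    ⟨y, mem_closedBall_self hR.le⟩ hgc.continuous.continuousOn
  have hxR : x ∈ closedBall y R := by
    by_contra h'; linarith [hout x h']
  have hgz : g z < 0 := (hzmin hxR).trans_lt hgx
  have hglob : ∀ t, g z ≤ g t := fun t => by
    by_cases ht : t ∈ closedBall y R
    · exact hzmin ht
    · linarith [hout t ht]
  have hzr : r < ‖z - y‖ := by
    by_contra! h'
    have h1 := hball z (by rwa [mem_closedBall, dist_eq_norm])
    have h2 : h z ≤ 1 := by
      have : G z ≤ 1 := by
        apply Real.exp_le_one_iff.2; nlinarith [sq_nonneg ‖z - y‖]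
      have := Real.exp_pos (-α * R ^ 2)
      simp only [hh]; linarith
    have : m * h z ≤ m := by nlinarith
    simp only [hg] at hgz; linarith
  have hΔg : 0 ≤ Δ g z :=
    laplacian_nonneg_of_isLocalMin hgc (Eventually.of_forall hglob)
  have hΔh : Δ h z = Δ G z := by
    have : Δ h z = Δ G z - Δ (fun _ : E => Real.exp (-α * R ^ 2)) z :=
      ContDiffAt.laplacian_sub hGc.contDiffAt contDiffAt_const
    rw [this, InnerProductSpace.laplacian_const]; simp
  have hΔg' : Δ g z = Δ f z - m * Δ G z := by
    have h1 : Δ g z = Δ f z - Δ (m • h) z :=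
      ContDiffAt.laplacian_sub hf.contDiffAt (contDiff_const.mul hhc).contDiffAt
    rw [h1, InnerProductSpace.laplacian_smul m hhc.contDiffAt, hΔh, smul_eq_mul]
  have hGz : 0 < G z := Real.exp_pos _
  have hsub : c * G z ≤ Δ G z := by
    rw [laplacian_gaussian]
    refine mul_le_mul_of_nonneg_right ?_ hGz.le
    nlinarith [mul_le_mul_of_nonneg_left (pow_le_pow_left₀ hr.le hzr.le 2)
      (by positivity : 0 ≤ 4 * α ^ 2)]
  have hfz : f z < m * G z := by
    have := mul_nonneg hm (Real.exp_pos (-α * R ^ 2)).le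
    simp only [hg, hh] at hgz; linarith
  nlinarith [hΔ z, mul_le_mul_of_nonneg_left hsub hm, mul_lt_mul_of_pos_left hfz hc]

/-- Maximum principle for a cooperative linear system: at a positive maximum of `max W Z`, the
larger of the two functions has a local maximum there, its coupling term is nonnegative, and its
Laplacian would be positive. The existence of the maximum is a hypothesis. -/
lemma max_nonpos_of_cooperative {W Z : E → ℝ} {a b a' b' : ℝ} (ha : 0 < a) (hb : 0 ≤ b)
    (ha' : 0 < a') (hb' : 0 ≤ b') (hW : ContDiff ℝ 2 W) (hZ : ContDiff ℝ 2 Z)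
    (hΔW : ∀ x, a * W x + b * (W x - Z x) ≤ Δ W x)
    (hΔZ : ∀ x, a' * Z x + b' * (Z x - W x) ≤ Δ Z x)
    (hmax : ∀ x, 0 < max (W x) (Z x) → ∃ z, ∀ y, max (W y) (Z y) ≤ max (W z) (Z z)) (x : E) :
    max (W x) (Z x) ≤ 0 := by
  by_contra! hx
  obtain ⟨z, hz⟩ := hmax x hx
  have hpos := hx.trans_le (hz x)
  rcases le_total (Z z) (W z) with h | h
  · rw [max_eq_left h] at hz hpos
    have h0 := laplacian_nonpos_of_isLocalMax hW
      (Eventually.of_forall fun y => (le_max_left _ _).trans (hz y))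
    nlinarith [hΔW z]
  · rw [max_eq_right h] at hz hpos
    have h0 := laplacian_nonpos_of_isLocalMax hZ
      (Eventually.of_forall fun y => (le_max_right _ _).trans (hz y))
    nlinarith [hΔZ z]

end Laplacian

/-! ### Mollification and weak differential inequalities -/

section Mollify

variable {E : Type*} [NormedAddCommGroup E] [InnerProductSpace ℝ E] [FiniteDimensional ℝ E]
  [MeasurableSpace E] [BorelSpace E]

/-- The mollification of `w`: its convolution with the bump function `ρ`, normalised to have
integral one. -/
def mollify (ρ : ContDiffBump (0 : E)) (w : E → ℝ) (x : E) : ℝ :=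
  ∫ y, w y * ρ.normed volume (x - y)

variable {ρ : ContDiffBump (0 : E)} {w : E → ℝ}

lemma integrable_mul_of_hasCompactSupport {w φ : E → ℝ} (hw : LocallyIntegrable w)
    (hφ : Continuous φ) (hc : HasCompactSupport φ) : Integrable (fun y => w y * φ y) := by
  simpa [mul_comm] using hw.integrable_smul_left_of_hasCompactSupport hφ hc

lemma contDiff_normed_sub (ρ : ContDiffBump (0 : E)) (x : E) :
    ContDiff ℝ (⊤ : ℕ∞) (fun y => ρ.normed volume (x - y)) :=
  ρ.contDiff_normed.comp (contDiff_const.sub contDiff_id)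

lemma hasCompactSupport_normed_sub (ρ : ContDiffBump (0 : E)) (x : E) :
    HasCompactSupport (fun y => ρ.normed volume (x - y)) :=
  ρ.hasCompactSupport_normed.comp_homeomorph (Homeomorph.subLeft x)

lemma integrable_mollify (hw : LocallyIntegrable w) (ρ : ContDiffBump (0 : E)) (x : E) :
    Integrable (fun y => w y * ρ.normed volume (x - y)) :=
  integrable_mul_of_hasCompactSupport hw (contDiff_normed_sub ρ x).continuous
    (hasCompactSupport_normed_sub ρ x)

/-- Convolution commutes with directional derivatives, these being taken on the smooth factor. -/
lemma fderiv_integral_mul_sub (hw : LocallyIntegrable w) {g : E → ℝ} (hg : ContDiff ℝ 1 g)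
    (hc : HasCompactSupport g) (x e : E) :
    fderiv ℝ (fun x => ∫ y, w y * g (x - y)) x e = ∫ y, w y * fderiv ℝ g (x - y) e := by
  have h := hc.hasFDerivAt_convolution_right (ContinuousLinearMap.mul ℝ ℝ) hw hg x
  have h' : HasFDerivAt (fun x => ∫ y, w y * g (x - y)) _ x := h
  rw [h'.fderiv, convolution_precompR_apply _ hw (hc.fderiv ℝ) (hg.continuous_fderiv one_ne_zero)]
  rfl

lemma contDiff_mollify (hw : LocallyIntegrable w) (ρ : ContDiffBump (0 : E)) :
    ContDiff ℝ 2 (mollify ρ w) :=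
  ρ.hasCompactSupport_normed.contDiff_convolution_right (n := 2) (ContinuousLinearMap.mul ℝ ℝ)
    hw (ρ.contDiff_normed (n := 2))

lemma laplacian_mollify (hw : LocallyIntegrable w) (ρ : ContDiffBump (0 : E)) (x : E) :
    Δ (mollify ρ w) x = ∫ y, w y * Δ (fun z => ρ.normed volume (x - z)) y := by
  have h2 : ContDiff ℝ 2 (ρ.normed (volume : Measure E)) := ρ.contDiff_normed (n := 2)
  have h1 : ContDiff ℝ 1 (ρ.normed (volume : Measure E)) := ρ.contDiff_normed (n := 1)
  have hd (e : E) : ContDiff ℝ 1 (fun y => fderiv ℝ (ρ.normed volume) y e) :=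
    contDiff_fderiv_apply (n := 1) h2 e
  have hdc (e : E) : HasCompactSupport (fun y => fderiv ℝ (ρ.normed volume) y e) :=
    ρ.hasCompactSupport_normed.fderiv_apply ℝ e
  rw [laplacian_eq_sum_fderiv (contDiff_mollify hw ρ)]
  simp_rw [laplacian_comp_const_sub h2, laplacian_eq_sum_fderiv h2, Finset.mul_sum]
  rw [integral_finsetSum]
  · refine Finset.sum_congr rfl fun i _ => ?_
    rw [← fderiv_integral_mul_sub hw (hd _) (hdc _)]
    congr 2
    funext y
    exact fderiv_integral_mul_sub hw h1 ρ.hasCompactSupport_normed y _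
  · intro i _
    refine integrable_mul_of_hasCompactSupport hw ?_ ?_
    · exact ((contDiff_fderiv_apply (n := 0) (hd _) _).continuous).comp
        (continuous_const.sub continuous_id)
    · exact ((hdc _).fderiv_apply ℝ _).comp_homeomorph (Homeomorph.subLeft x)

lemma integral_normed_sub (ρ : ContDiffBump (0 : E)) (x : E) :
    ∫ y, ρ.normed volume (x - y) = 1 := by
  rw [integral_sub_left_eq_self (fun y => ρ.normed volume y) volume x, ρ.integral_normed]

lemma le_mollify (hw : LocallyIntegrable w) {x : E} {m : ℝ}
    (h : ∀ᵐ y, y ∈ ball x ρ.rOut → m ≤ w y) : m ≤ mollify ρ w x := by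
  have h1 : m = ∫ y, m * ρ.normed volume (x - y) := by
    rw [integral_const_mul, integral_normed_sub, mul_one]
  rw [h1]
  refine integral_mono_ae ?_ (integrable_mollify hw ρ x) ?_
  · exact (integrable_mollify (w := fun _ => m) (locallyIntegrable_const m) ρ x)
  · filter_upwards [h] with y hy
    by_cases hyb : y ∈ ball x ρ.rOut
    · exact mul_le_mul_of_nonneg_right (hy hyb) (ρ.nonneg_normed _)
    · have : ρ.normed volume (x - y) = 0 := by
        rw [← Function.notMem_support, ρ.support_normed_eq]
        simpa [dist_eq_norm, norm_sub_rev] using hyb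
      simp [this]

lemma mollify_neg (ρ : ContDiffBump (0 : E)) (w : E → ℝ) (x : E) :
    mollify ρ (fun y => -w y) x = -mollify ρ w x := by
  simp [mollify, integral_neg]

lemma mollify_le (hw : LocallyIntegrable w) {x : E} {m : ℝ}
    (h : ∀ᵐ y, y ∈ ball x ρ.rOut → w y ≤ m) : mollify ρ w x ≤ m := by
  have := le_mollify (ρ := ρ) (w := fun y => -w y) hw.neg (x := x) (m := -m)
    (by filter_upwards [h] with y hy hyb using neg_le_neg (hy hyb))
  rw [mollify_neg] at this
  linarith

lemma mollify_linear {u v : E → ℝ} (hu : LocallyIntegrable u) (hv : LocallyIntegrable v)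
    (a b : ℝ) (ρ : ContDiffBump (0 : E)) (x : E) :
    mollify ρ (fun y => a * u y + b * v y) x = a * mollify ρ u x + b * mollify ρ v x := by
  simp only [mollify]
  rw [← integral_const_mul, ← integral_const_mul, ← integral_add]
  · congr 1; funext y; ring
  · exact (integrable_mollify hu ρ x).const_mul a
  · exact (integrable_mollify hv ρ x).const_mul b

lemma mollify_congr_ae {u v : E → ℝ} (h : u =ᵐ[volume] v) (ρ : ContDiffBump (0 : E)) (x : E) :
    mollify ρ u x = mollify ρ v x :=
  integral_congr_ae (by filter_upwards [h] with y hy; simp [hy])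

lemma mollify_add_right (ρ : ContDiffBump (0 : E)) (w : E → ℝ) (x l : E) :
    mollify ρ w (x + l) = mollify ρ (fun y => w (y + l)) x := by
  simp only [mollify]
  rw [← integral_add_right_eq_self _ l]
  simp

/-- Bump functions at the origin whose supports shrink to a point as `n → ∞`. -/
def shrinkingBump (E : Type*) [NormedAddCommGroup E] (n : ℕ) :
    ContDiffBump (0 : E) where
  rIn := 1 / (2 * ((n : ℝ) + 1))
  rOut := 1 / ((n : ℝ) + 1)
  rIn_pos := by positivity
  rIn_lt_rOut := one_div_lt_one_div_of_lt (by positivity) (by linarith [n.cast_nonneg (α := ℝ)])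

omit [InnerProductSpace ℝ E] [FiniteDimensional ℝ E] [MeasurableSpace E] [BorelSpace E] in
lemma tendsto_shrinkingBump : Tendsto (fun n => (shrinkingBump E n).rOut) atTop (𝓝 0) :=
  tendsto_one_div_add_atTop_nhds_zero_nat

lemma tendsto_mollify (hw : LocallyIntegrable w) {x : E} (hx : ContinuousAt w x) :
    Tendsto (fun n => mollify (shrinkingBump E n) w x) atTop (𝓝 (w x)) := by
  have h := ContDiffBump.convolution_tendsto_right (μ := (volume : Measure E))
    (φ := shrinkingBump E) (g := fun _ => w)
    (k := fun _ => x) (x₀ := x) (z₀ := w x) (l := atTop) tendsto_shrinkingBump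
    (Eventually.of_forall fun _ => hw.aestronglyMeasurable) (hx.tendsto.comp tendsto_snd)
    tendsto_const_nhds
  refine h.congr fun n => ?_
  rw [convolution_eq_swap]
  simp [mollify, mul_comm]

/-- `Δ w ≥ h` in the sense of distributions. -/
def WeakSub (w h : E → ℝ) : Prop :=
  ∀ φ : E → ℝ, ContDiff ℝ (⊤ : ℕ∞) φ → HasCompactSupport φ → (∀ x, 0 ≤ φ x) →
    ∫ x, h x * φ x ≤ ∫ x, w x * Δ φ x

/-- Mollification turns a distributional inequality into a pointwise one: the translates of `ρ` are
admissible test functions. -/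
lemma WeakSub.mollify_le {h : E → ℝ} (hwh : WeakSub w h) (hw : LocallyIntegrable w)
    (ρ : ContDiffBump (0 : E)) (x : E) : mollify ρ h x ≤ Δ (mollify ρ w) x := by
  rw [laplacian_mollify hw]
  exact hwh _ (contDiff_normed_sub ρ x) (hasCompactSupport_normed_sub ρ x)
    fun y => ρ.nonneg_normed _

lemma nonpos_of_tendsto_mollify (hw : LocallyIntegrable w) {x : E} (hx : ContinuousAt w x)
    (h : ∀ ρ : ContDiffBump (0 : E), mollify ρ w x ≤ 0) : w x ≤ 0 :=
  le_of_tendsto' (tendsto_mollify hw hx) fun _ => h _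

/-- Strong maximum principle: suppose `w ≤ 0` satisfies `Δ w ≥ c w + μ δ_q` as a distribution and is
continuous off the closed null set `S`. If `w` vanished at a point off `S`, then `exists_barrier_le`,
applied to the mollifications of `-w`, would make it vanish almost everywhere, which the point mass
at `q` excludes. No connectedness of the complement of `S` is needed, because the mollifications are
supersolutions on the whole space. -/
lemma neg_of_weakSub {c μ : ℝ} (hc : 0 < c) (hμ : 0 < μ) {q : E} {S : Set E}
    (hS : IsClosed S) (hS0 : volume S = 0) (hw : LocallyIntegrable w) (hwc : ContinuousOn w Sᶜ)
    (hw0 : ∀ x ∈ Sᶜ, w x ≤ 0)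
    (hsub : ∀ φ : E → ℝ, ContDiff ℝ (⊤ : ℕ∞) φ → HasCompactSupport φ → (∀ x, 0 ≤ φ x) →
      (∫ x, c * w x * φ x) + μ * φ q ≤ ∫ x, w x * Δ φ x) :
    ∀ x ∈ Sᶜ, w x < 0 := by
  have hae : ∀ᵐ y, y ∈ Sᶜ := by
    rw [← compl_mem_ae_iff] at hS0; exact hS0
  have hcont : ∀ x ∈ Sᶜ, ContinuousAt w x := fun x hx =>
    hwc.continuousAt (hS.isOpen_compl.mem_nhds hx)
  have hweak : WeakSub w (fun y => c * w y + 0 * w y) := fun φ h1 h2 h3 => by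
    have := hsub φ h1 h2 h3
    simp only [zero_mul, add_zero]
    nlinarith [h3 q]
  intro x₀ hx₀
  refine lt_of_le_of_ne (hw0 x₀ hx₀) fun hzero => ?_
  -- a zero of `w` propagates to all points of continuity, whatever their distance
  have hall : ∀ y ∈ Sᶜ, w y = 0 := by
    intro y hy
    by_contra hne
    have hyneg : w y < 0 := lt_of_le_of_ne (hw0 y hy) hne
    have hev : ∀ᶠ z in 𝓝 y, w z < w y / 2 := (hcont y hy).eventually_lt_const (by linarith)
    obtain ⟨r, hr, hball⟩ := Metric.eventually_nhds_iff_ball.1 hev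
    obtain ⟨α, hα, hbar⟩ := exists_barrier_le (E := E) c hc (r := r / 2)
      (R := dist x₀ y + 1) (by positivity) (by positivity)
    set δ : ℝ := -(w y / 2) * (Real.exp (-α * ‖x₀ - y‖ ^ 2) -
      Real.exp (-α * (dist x₀ y + 1) ^ 2)) with hδ
    have hδ0 : 0 < δ := by
      refine mul_pos (by linarith) (sub_pos.2 (Real.exp_lt_exp.2 ?_))
      rw [dist_eq_norm]
      nlinarith [norm_nonneg (x₀ - y)]
    have hlim := tendsto_mollify hw (hcont x₀ hx₀)
    rw [hzero] at hlim
    have hle : ∀ᶠ n in atTop, mollify (shrinkingBump E n) w x₀ ≤ -δ := by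
      filter_upwards [(tendsto_shrinkingBump (E := E)).eventually_lt_const
        (by positivity : (0 : ℝ) < r / 2)] with n hn
      have := hbar (fun x => -mollify (shrinkingBump E n) w x) y (-(w y / 2))
        (contDiff_mollify hw _).neg
        (fun x => neg_nonneg.2 (Vortex.mollify_le hw (by
          filter_upwards [hae] with z hz _ using hw0 z hz)))
        (fun x => by
          have h1 := hweak.mollify_le hw (shrinkingBump E n) x
          rw [mollify_linear hw hw] at h1
          have h2 : Δ (fun x => -mollify (shrinkingBump E n) w x) x =
              -Δ (mollify (shrinkingBump E n) w) x := by
            change Δ (-mollify (shrinkingBump E n) w) x = _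
            rw [InnerProductSpace.laplacian_neg]; rfl
          rw [h2]; linarith)
        (by linarith)
        (fun x hx => by
          refine le_neg.1 ?_
          rw [neg_neg]
          refine Vortex.mollify_le hw (Eventually.of_forall fun z hz => (hball z ?_).le)
          rw [mem_ball] at hz ⊢
          rw [mem_closedBall] at hx
          linarith [dist_triangle z x y])
        x₀
      linarith
    have := le_of_tendsto hlim hle
    linarith
  have hw_ae : w =ᵐ[volume] 0 := by
    filter_upwards [hae] with y hy using hall y hy
  -- testing with a bump at `q` now contradicts `0 < μ`
  let b : ContDiffBump q := ⟨1, 2, one_pos, one_lt_two⟩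
  have hb := hsub b b.contDiff b.hasCompactSupport (fun x => b.nonneg)
  have h1 : ∫ x, w x * Δ (b : E → ℝ) x = 0 := by
    rw [integral_eq_zero_of_ae]
    filter_upwards [hw_ae] with y hy
    simp [hy]
  have h2 : ∫ x, c * w x * b x = 0 := by
    rw [integral_eq_zero_of_ae]
    filter_upwards [hw_ae] with y hy
    simp [hy]
  rw [h1, h2, b.one_of_mem_closedBall (mem_closedBall_self b.rIn_pos.le)] at hb
  linarith

end Mollify

/-! ### The vortex measure -/

section Lattice

variable {L : AddSubgroup Plane} {N N' : ℕ}

lemma vortexSet_eq_iUnion (L : AddSubgroup Plane) (p : Fin N → Plane) :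
    vortexSet L p = ⋃ s, (fun x => x - p s) ⁻¹' (L : Set Plane) := by
  ext x; simp [vortexSet]

lemma isClosed_vortexSet [DiscreteTopology L] (p : Fin N → Plane) : IsClosed (vortexSet L p) := by
  rw [vortexSet_eq_iUnion]
  have hL : IsClosed (L : Set Plane) := AddSubgroup.isClosed_of_discrete
  exact isClosed_iUnion_of_finite fun s => hL.preimage (continuous_id.sub continuous_const)

lemma countable_vortexSet [DiscreteTopology L] (p : Fin N → Plane) :
    (vortexSet L p).Countable := by
  rw [vortexSet_eq_iUnion]
  have hL : (L : Set Plane).Countable := by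
    have : Countable L := countable_of_Lindelof_of_discrete
    exact Set.to_countable _
  exact Set.countable_iUnion fun s => hL.preimage fun _ _ h => sub_left_injective h

lemma finite_inter_vortexSet [DiscreteTopology L] (p : Fin N → Plane) {K : Set Plane}
    (hK : IsCompact K) : (K ∩ vortexSet L p).Finite := by
  rw [vortexSet_eq_iUnion, Set.inter_iUnion]
  refine Set.finite_iUnion fun s => ?_
  have hL : IsClosed (L : Set Plane) := AddSubgroup.isClosed_of_discrete
  have hb : Bornology.IsBounded ((fun x => x - p s) '' K) :=
    (hK.image (continuous_id.sub continuous_const)).isBounded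
  have hf := Metric.finite_isBounded_inter_isClosed (s := (L : Set Plane))
    DiscreteTopology.isDiscrete hb hL
  refine Set.Finite.of_finite_image (f := fun x => x - p s) (hf.subset ?_)
    (sub_left_injective.injOn)
  rintro _ ⟨x, ⟨hx, hxL⟩, rfl⟩
  exact ⟨⟨x, hx, rfl⟩, hxL⟩

/-- The pairing of `φ` with the sum of the unit masses at the vortices `p s` and all their
translates under `L`. -/
def vortexSum (L : AddSubgroup Plane) (p : Fin N → Plane) (φ : Plane → ℝ) : ℝ :=
  ∑ s : Fin N, ∑' l : L, φ (p s + (l : Plane))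

/-- The vortex masses regrouped by position; `F` may be any finite set that contains the vortices
where `φ` does not vanish. -/
lemma vortexSum_eq_sum_mult (p : Fin N → Plane) {φ : Plane → ℝ} {F : Finset Plane}
    (hF : ∀ x ∈ vortexSet L p, φ x ≠ 0 → x ∈ F) :
    vortexSum L p φ = ∑ x ∈ F, vortexMult L p x * φ x := by
  classical
  have h1 (s : Fin N) : ∑' l : L, φ (p s + (l : Plane)) =
      ∑ x ∈ F, if x - p s ∈ L then φ x else 0 := by
    have hinj : Function.Injective (fun l : L => p s + (l : Plane)) :=
      fun a b h => Subtype.ext (add_left_cancel h)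
    have h := hinj.tsum_eq (f := fun x => if x - p s ∈ L then φ x else 0) (by
      intro x hx
      have hx' : x - p s ∈ L := by
        by_contra h'; simp [h'] at hx
      exact ⟨⟨x - p s, hx'⟩, by simp⟩)
    simp only [add_sub_cancel_left, SetLike.coe_mem, if_true] at h
    rw [h]
    refine tsum_eq_sum fun x hx => ?_
    by_contra h0
    have hx' : x - p s ∈ L := by
      by_contra h'; simp [h'] at h0
    exact hx (hF x ⟨s, hx'⟩ (by simpa [hx'] using h0))
  simp only [vortexSum, h1]
  rw [Finset.sum_comm]
  refine Finset.sum_congr rfl fun x _ => ?_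
  rw [← Finset.sum_filter, Finset.sum_const, nsmul_eq_mul, vortexMult,
    Set.ncard_eq_toFinset_card', Set.toFinset_ofPred]

/-- A combination of two vortex measures whose weights are nonnegative at every position dominates
its mass at any single position `q`. -/
lemma le_vortexSum_comb [DiscreteTopology L] (p : Fin N → Plane) (p' : Fin N' → Plane)
    {c c' : ℝ} (hc : ∀ x, 0 ≤ c * vortexMult L p x + c' * vortexMult L p' x)
    {φ : Plane → ℝ} (hφ : HasCompactSupport φ) (hφ0 : ∀ x, 0 ≤ φ x) (q : Plane) :
    (c * vortexMult L p q + c' * vortexMult L p' q) * φ q ≤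
      c * vortexSum L p φ + c' * vortexSum L p' φ := by
  classical
  set F : Finset Plane := insert q ((finite_inter_vortexSet (L := L) p hφ).toFinset ∪
    (finite_inter_vortexSet (L := L) p' hφ).toFinset) with hF
  rw [vortexSum_eq_sum_mult p (F := F) fun x hx h0 => by
      simp [hF, hx, subset_tsupport φ h0],
    vortexSum_eq_sum_mult p' (F := F) fun x hx h0 => by
      simp [hF, hx, subset_tsupport φ h0],
    Finset.mul_sum, Finset.mul_sum, ← Finset.sum_add_distrib]
  have h := Finset.single_le_sum (s := F)
    (f := fun x => (c * vortexMult L p x + c' * vortexMult L p' x) * φ x)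
    (fun x _ => mul_nonneg (hc x) (hφ0 x)) (Finset.mem_insert_self q _)
  refine h.trans_eq (Finset.sum_congr rfl fun x _ => ?_)
  ring

lemma vortexMult_pos (p : Fin N → Plane) (s : Fin N) : 0 < vortexMult L p (p s) :=
  (Set.ncard_pos (Set.toFinite _)).2 ⟨s, by simp⟩

end Lattice

/-! ### Reduction to a cooperative linear system -/

section Core

variable {L : AddSubgroup Plane} {N₁ N₂ : ℕ} {p₁ : Fin N₁ → Plane} {p₂ : Fin N₂ → Plane}

/-- A combination of two Poisson equations, weakened by bounding the regular part from below and by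
keeping only the point mass at one position `q`. -/
lemma SolvesPoisson.le_comb [DiscreteTopology L] {u₁ u₂ f₁ f₂ g : Plane → ℝ}
    (h₁ : SolvesPoisson L p₁ u₁ f₁) (h₂ : SolvesPoisson L p₂ u₂ f₂) {c c' : ℝ}
    (hmult : ∀ x, 0 ≤ c * vortexMult L p₁ x + c' * vortexMult L p₂ x)
    (hg : LocallyIntegrable g) (hle : ∀ᵐ x, g x ≤ c * f₁ x + c' * f₂ x) (q : Plane)
    {φ : Plane → ℝ} (hφ : ContDiff ℝ (⊤ : ℕ∞) φ) (hφc : HasCompactSupport φ)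
    (hφ0 : ∀ x, 0 ≤ φ x) :
    (∫ x, g x * φ x) +
        4 * Real.pi * (c * vortexMult L p₁ q + c' * vortexMult L p₂ q) * φ q ≤
      ∫ x, (c * u₁ x + c' * u₂ x) * Δ φ x := by
  have hφ2 : ContDiff ℝ 2 φ := contDiff_infty.1 hφ 2
  have hΔ := continuous_laplacian hφ2
  have hΔc := hasCompactSupport_laplacian hφ2 hφc
  have e₁ := h₁.eq φ hφ hφc
  have e₂ := h₂.eq φ hφ hφc
  have hL : ∫ x, (c * u₁ x + c' * u₂ x) * Δ φ x =
      c * (∫ x, u₁ x * Δ φ x) + c' * ∫ x, u₂ x * Δ φ x := by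
    rw [← integral_const_mul, ← integral_const_mul, ← integral_add]
    · congr 1; funext y; ring
    · exact (integrable_mul_of_hasCompactSupport h₁.locallyIntegrable hΔ hΔc).const_mul _
    · exact (integrable_mul_of_hasCompactSupport h₂.locallyIntegrable hΔ hΔc).const_mul _
  have i₁ := (integrable_mul_of_hasCompactSupport h₁.locallyIntegrable_rhs hφ.continuous
    hφc).const_mul c
  have i₂ := (integrable_mul_of_hasCompactSupport h₂.locallyIntegrable_rhs hφ.continuous
    hφc).const_mul c'
  have hR : ∫ x, g x * φ x ≤ c * (∫ x, f₁ x * φ x) + c' * ∫ x, f₂ x * φ x := by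
    rw [← integral_const_mul, ← integral_const_mul, ← integral_add i₁ i₂]
    refine integral_mono_ae (integrable_mul_of_hasCompactSupport hg hφ.continuous hφc)
      (i₁.add i₂) ?_
    filter_upwards [hle] with x hx
    have := mul_le_mul_of_nonneg_right hx (hφ0 x)
    linarith
  have hD := mul_le_mul_of_nonneg_left (le_vortexSum_comb p₁ p₂ hmult hφc hφ0 q)
    (by positivity : 0 ≤ 4 * Real.pi)
  rw [hL, e₁, e₂]
  simp only [vortexSum] at hD
  linarith

/-- The exponential nonlinearity of `Δ (u₁ / λ₁ + u₂ / λ₂)` lies above its linearisation at zero,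
since `t ≤ exp t - 1`; the terms with `C` cancel. -/
lemma linear_le_rhs_add {m : ℕ} {lam₁ lam₂ : ℝ} (hlam₁ : 0 < lam₁) (hlam₂ : 0 < lam₂)
    (A B C : ℂ) (u₁ u₂ : Plane → ℝ) (x : Plane) :
    (m : ℝ) ^ 2 * ‖A‖ ^ 2 * u₁ x + 2 * ‖B‖ ^ 2 * (u₁ x + u₂ x) ≤
      lam₁⁻¹ * rhs₁ m lam₁ A B C u₁ u₂ x + lam₂⁻¹ * rhs₂ lam₂ B C u₁ u₂ x := by
  rw [rhs₁, rhs₂, inv_mul_cancel_left₀ hlam₁.ne', inv_mul_cancel_left₀ hlam₂.ne']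
  nlinarith [mul_le_mul_of_nonneg_left (Real.add_one_le_exp (m * u₁ x))
      (by positivity : 0 ≤ m * ‖A‖ ^ 2),
    mul_le_mul_of_nonneg_left (Real.add_one_le_exp (u₁ x + u₂ x)) (sq_nonneg ‖B‖)]

/-- The counterpart for `Δ (u₁ / λ₁ - u₂ / λ₂)`, where the terms with `B` cancel. -/
lemma linear_le_rhs_sub {m : ℕ} {lam₁ lam₂ : ℝ} (hlam₁ : 0 < lam₁) (hlam₂ : 0 < lam₂)
    (A B C : ℂ) (u₁ u₂ : Plane → ℝ) (x : Plane) :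
    (m : ℝ) ^ 2 * ‖A‖ ^ 2 * u₁ x + 2 * ‖C‖ ^ 2 * (u₁ x - u₂ x) ≤
      lam₁⁻¹ * rhs₁ m lam₁ A B C u₁ u₂ x + -lam₂⁻¹ * rhs₂ lam₂ B C u₁ u₂ x := by
  rw [rhs₁, rhs₂, inv_mul_cancel_left₀ hlam₁.ne', neg_mul, inv_mul_cancel_left₀ hlam₂.ne']
  nlinarith [mul_le_mul_of_nonneg_left (Real.add_one_le_exp (m * u₁ x))
      (by positivity : 0 ≤ m * ‖A‖ ^ 2),
    mul_le_mul_of_nonneg_left (Real.add_one_le_exp (u₁ x - u₂ x)) (sq_nonneg ‖C‖)]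

/-- The sign result for any discrete group of periods `L`, assuming that the larger of the two
mollified functions attains its maximum if it is positive somewhere. -/
theorem neg_of_isSolution [DiscreteTopology L] {m : ℕ} {lam₁ lam₂ : ℝ} (hlam₁ : 0 < lam₁)
    (hlam : lam₁ < lam₂) {A B C : ℂ} (hBC : ‖C‖ < ‖B‖)
    (hA : (m : ℝ) ^ 2 * ‖A‖ ^ 2 < 2 * (lam₂ / lam₁ - 1) * ‖C‖ ^ 2) (hN₁ : 0 < N₁)
    {u₁ u₂ : Plane → ℝ} (hmult : ∀ x, vortexMult L p₂ x ≤ vortexMult L p₁ x)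
    (hsol : IsSolution L m lam₁ lam₂ A B C p₁ p₂ u₁ u₂) {W Z : Plane → ℝ}
    (hW : W = fun x => lam₁⁻¹ * u₁ x + lam₂⁻¹ * u₂ x)
    (hZ : Z = fun x => lam₁⁻¹ * u₁ x + -lam₂⁻¹ * u₂ x)
    (hmax : ∀ (ρ : ContDiffBump (0 : Plane)) (x : Plane),
      0 < max (mollify ρ W x) (mollify ρ Z x) →
      ∃ z, ∀ y, max (mollify ρ W y) (mollify ρ Z y) ≤ max (mollify ρ W z) (mollify ρ Z z))
    {x : Plane} (hx : x ∉ vortexSet L p₁ ∪ vortexSet L p₂) :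
    u₁ x / lam₁ + u₂ x / lam₂ < 0 ∧ u₁ x / lam₁ - u₂ x / lam₂ < 0 ∧ u₁ x < 0 := by
  have hlam₂ : 0 < lam₂ := hlam₁.trans hlam
  set S : Set Plane := vortexSet L p₁ ∪ vortexSet L p₂ with hSdef
  have hS : IsClosed S := (isClosed_vortexSet p₁).union (isClosed_vortexSet p₂)
  have hS0 : volume S = 0 :=
    ((countable_vortexSet p₁).union (countable_vortexSet p₂)).measure_zero _
  have hae : ∀ᵐ y, y ∈ Sᶜ := by
    rw [← compl_mem_ae_iff] at hS0; exact hS0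
  -- the coefficients of the linear system; the hypothesis on `A` is equivalent to `0 < b'`
  set α : ℝ := (m : ℝ) ^ 2 * ‖A‖ ^ 2 with hα
  have hα0 : 0 ≤ α := by positivity
  have hA' : α * lam₁ < 2 * (lam₂ - lam₁) * ‖C‖ ^ 2 := by
    have := mul_lt_mul_of_pos_right hA hlam₁
    have e : 2 * (lam₂ / lam₁ - 1) * ‖C‖ ^ 2 * lam₁ = 2 * (lam₂ - lam₁) * ‖C‖ ^ 2 := by
      field_simp
    linarith
  have hC : 0 < ‖C‖ ^ 2 := by
    by_contra! h
    nlinarith [mul_nonneg hα0 hlam₁.le]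
  have hBC' : ‖C‖ ^ 2 < ‖B‖ ^ 2 := pow_lt_pow_left₀ hBC (norm_nonneg _) two_ne_zero
  set a : ℝ := lam₁ * (α + 2 * ‖B‖ ^ 2) with ha_def
  set b : ℝ := ‖B‖ ^ 2 * (lam₂ - lam₁) - α * lam₁ / 2 with hb_def
  set a' : ℝ := lam₁ * (α + 2 * ‖C‖ ^ 2) with ha'_def
  set b' : ℝ := ‖C‖ ^ 2 * (lam₂ - lam₁) - α * lam₁ / 2 with hb'_def
  have ha : 0 < a := mul_pos hlam₁ (by linarith)
  have ha' : 0 < a' := mul_pos hlam₁ (by linarith)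
  have hb' : 0 < b' := by rw [hb'_def]; linarith
  have hb : 0 < b := by
    have := mul_lt_mul_of_pos_right hBC' (sub_pos.2 hlam)
    rw [hb_def]; linarith
  have hlin (x : Plane) : a * W x + b * (W x - Z x) =
      α * u₁ x + 2 * ‖B‖ ^ 2 * (u₁ x + u₂ x) := by
    rw [hW, hZ, ha_def, hb_def]; field_simp; ring
  have hlin' (x : Plane) : a' * Z x + b' * (Z x - W x) =
      α * u₁ x + 2 * ‖C‖ ^ 2 * (u₁ x - u₂ x) := by
    rw [hW, hZ, ha'_def, hb'_def]; field_simp; ring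
  have hle (x : Plane) := (hlin x).trans_le
    (linear_le_rhs_add (m := m) hlam₁ hlam₂ A B C u₁ u₂ x)
  have hle' (x : Plane) := (hlin' x).trans_le
    (linear_le_rhs_sub (m := m) hlam₁ hlam₂ A B C u₁ u₂ x)
  have hu₁ := hsol.eq₁.locallyIntegrable
  have hu₂ := hsol.eq₂.locallyIntegrable
  have hWi : LocallyIntegrable W := by
    rw [hW]; exact (hu₁.smul lam₁⁻¹).add (hu₂.smul lam₂⁻¹)
  have hZi : LocallyIntegrable Z := by
    rw [hZ]; exact (hu₁.smul lam₁⁻¹).add (hu₂.smul (-lam₂⁻¹))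
  have hWc : ContinuousOn W Sᶜ := by
    rw [hW]; exact (continuousOn_const.mul hsol.continuousOn₁).add
      (continuousOn_const.mul hsol.continuousOn₂)
  have hZc : ContinuousOn Z Sᶜ := by
    rw [hZ]; exact (continuousOn_const.mul hsol.continuousOn₁).add
      (continuousOn_const.mul hsol.continuousOn₂)
  have hm (x : Plane) : 0 ≤ lam₁⁻¹ * vortexMult L p₁ x + lam₂⁻¹ * vortexMult L p₂ x := by
    positivity
  have hinv : lam₂⁻¹ < lam₁⁻¹ := inv_strictAnti₀ hlam₁ hlam
  have hm_le (x : Plane) : (lam₁⁻¹ - lam₂⁻¹) * vortexMult L p₁ x ≤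
      lam₁⁻¹ * vortexMult L p₁ x + -lam₂⁻¹ * vortexMult L p₂ x := by
    have h : (vortexMult L p₂ x : ℝ) ≤ vortexMult L p₁ x := by exact_mod_cast hmult x
    have := mul_le_mul_of_nonneg_left h (inv_pos.2 hlam₂).le
    linarith
  have hm' (x : Plane) : 0 ≤ lam₁⁻¹ * vortexMult L p₁ x + -lam₂⁻¹ * vortexMult L p₂ x :=
    (mul_nonneg (sub_nonneg.2 hinv.le) (Nat.cast_nonneg _)).trans (hm_le x)
  set q : Plane := p₁ ⟨0, hN₁⟩ with hq
  have hq0 : (0 : ℝ) < vortexMult L p₁ q := by exact_mod_cast vortexMult_pos p₁ ⟨0, hN₁⟩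
  -- the linear system holds in the sense of distributions, hence pointwise after mollification
  have hWsub : WeakSub W (fun x => (a + b) * W x + -b * Z x) := fun φ h1 h2 h3 => by
    have := hsol.eq₁.le_comb hsol.eq₂ hm ((hWi.smul (a + b)).add (hZi.smul (-b)))
      (Eventually.of_forall fun x => le_of_eq_of_le (by simp; ring) (hle x)) q h1 h2 h3
    have hp : 0 ≤ 4 * Real.pi * (lam₁⁻¹ * vortexMult L p₁ q + lam₂⁻¹ * vortexMult L p₂ q) * φ q :=
      mul_nonneg (mul_nonneg (by positivity) (hm q)) (h3 q)
    rw [hW] at this ⊢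
    exact (le_add_of_nonneg_right hp).trans this
  have hZsub : WeakSub Z (fun x => (a' + b') * Z x + -b' * W x) := fun φ h1 h2 h3 => by
    have := hsol.eq₁.le_comb hsol.eq₂ hm' ((hZi.smul (a' + b')).add (hWi.smul (-b')))
      (Eventually.of_forall fun x => le_of_eq_of_le (by simp; ring) (hle' x)) q h1 h2 h3
    have hp : 0 ≤ 4 * Real.pi * (lam₁⁻¹ * vortexMult L p₁ q + -lam₂⁻¹ * vortexMult L p₂ q) * φ q :=
      mul_nonneg (mul_nonneg (by positivity) (hm' q)) (h3 q)
    rw [hZ] at this ⊢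
    exact (le_add_of_nonneg_right hp).trans this
  have hmoll (ρ : ContDiffBump (0 : Plane)) (x : Plane) :
      max (mollify ρ W x) (mollify ρ Z x) ≤ 0 := by
    refine max_nonpos_of_cooperative ha hb.le ha' hb'.le (contDiff_mollify hWi ρ)
      (contDiff_mollify hZi ρ) (fun x => ?_) (fun x => ?_) (hmax ρ) x
    · have := hWsub.mollify_le hWi ρ x
      rw [mollify_linear hWi hZi] at this
      linarith
    · have := hZsub.mollify_le hZi ρ x
      rw [mollify_linear hZi hWi] at this
      linarith
  have hW0 : ∀ x ∈ Sᶜ, W x ≤ 0 := fun x hx =>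
    nonpos_of_tendsto_mollify hWi (hWc.continuousAt (hS.isOpen_compl.mem_nhds hx))
      fun ρ => (le_max_left _ _).trans (hmoll ρ x)
  have hZ0 : ∀ x ∈ Sᶜ, Z x ≤ 0 := fun x hx =>
    nonpos_of_tendsto_mollify hZi (hZc.continuousAt (hS.isOpen_compl.mem_nhds hx))
      fun ρ => (le_max_right _ _).trans (hmoll ρ x)
  -- once both signs are known, the coupling terms have a sign and the inequalities decouple
  have hWneg : W x < 0 := by
    refine neg_of_weakSub (c := a + b)
      (μ := 4 * Real.pi * (lam₁⁻¹ * vortexMult L p₁ q + lam₂⁻¹ * vortexMult L p₂ q))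
      (by linarith) (by positivity) (q := q) hS hS0 hWi hWc hW0 (fun φ h1 h2 h3 => ?_) x hx
    have := hsol.eq₁.le_comb hsol.eq₂ hm (hWi.smul (a + b))
      (by
        filter_upwards [hae] with y hy
        have := mul_nonpos_of_nonneg_of_nonpos hb.le (hZ0 y hy)
        have := hle y
        simp only [Pi.smul_apply, smul_eq_mul]
        linarith) q h1 h2 h3
    rw [hW] at this ⊢
    exact this
  have hZneg : Z x < 0 := by
    refine neg_of_weakSub (c := a' + b')
      (μ := 4 * Real.pi * (lam₁⁻¹ * vortexMult L p₁ q + -lam₂⁻¹ * vortexMult L p₂ q))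
      (by linarith)
      (mul_pos (by positivity) ((mul_pos (sub_pos.2 hinv) hq0).trans_le (hm_le q))) (q := q)
      hS hS0 hZi hZc hZ0 (fun φ h1 h2 h3 => ?_) x hx
    have := hsol.eq₁.le_comb hsol.eq₂ hm' (hZi.smul (a' + b'))
      (by
        filter_upwards [hae] with y hy
        have := mul_nonpos_of_nonneg_of_nonpos hb'.le (hW0 y hy)
        have := hle' y
        simp only [Pi.smul_apply, smul_eq_mul]
        linarith) q h1 h2 h3
    rw [hZ] at this ⊢
    exact this
  have h1 : u₁ x / lam₁ + u₂ x / lam₂ < 0 := by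
    rw [hW] at hWneg; rw [div_eq_inv_mul, div_eq_inv_mul]; exact hWneg
  have h2 : u₁ x / lam₁ - u₂ x / lam₂ < 0 := by
    rw [hZ] at hZneg; rw [div_eq_inv_mul, div_eq_inv_mul]; linarith
  refine ⟨h1, h2, ?_⟩
  have h3 : u₁ x / lam₁ < 0 := by linarith
  exact (div_neg_iff.1 h3).resolve_left (fun h => by linarith [h.2]) |>.1

end Core

/-! ### Existence of a maximum in the planar and the periodic case -/

section Max

/-- Mollifications of functions that tend to zero are eventually below any positive value, so a
positive supremum is attained. -/
lemma exists_max_of_tendsto_zero {W Z : Plane → ℝ} (hWi : LocallyIntegrable W)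
    (hZi : LocallyIntegrable Z) (hW : Tendsto W (cocompact Plane) (𝓝 0))
    (hZ : Tendsto Z (cocompact Plane) (𝓝 0)) (ρ : ContDiffBump (0 : Plane)) (x : Plane)
    (hx : 0 < max (mollify ρ W x) (mollify ρ Z x)) :
    ∃ z, ∀ y, max (mollify ρ W y) (mollify ρ Z y) ≤ max (mollify ρ W z) (mollify ρ Z z) := by
  have key {V : Plane → ℝ} (hVi : LocallyIntegrable V)
      (hV : Tendsto V (cocompact Plane) (𝓝 0)) {ε : ℝ} (hε : 0 < ε) :
      ∀ᶠ y in cocompact Plane, mollify ρ V y ≤ ε := by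
    have h := hV.eventually_le_const hε
    rw [← Metric.cobounded_eq_cocompact, ← comap_norm_atTop, eventually_comap] at h ⊢
    obtain ⟨R, hR⟩ := eventually_atTop.1 h
    refine eventually_atTop.2 ⟨R + ρ.rOut, fun r hr y hy => ?_⟩
    refine mollify_le hVi (Eventually.of_forall fun t ht => hR ‖t‖ ?_ t rfl)
    rw [mem_ball, dist_eq_norm] at ht
    linarith [norm_sub_norm_le y t, norm_sub_rev y t]
  refine ((contDiff_mollify hWi ρ).continuous.max
    (contDiff_mollify hZi ρ).continuous).exists_forall_ge' x ?_
  filter_upwards [key hWi hW hx, key hZi hZ hx] with y h1 h2 using max_le h1 h2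

lemma exists_max_of_periodic {ι : Type*} [Fintype ι] (b : Module.Basis ι ℝ Plane)
    {g : Plane → ℝ} (hg : Continuous g)
    (hper : ∀ l ∈ Submodule.span ℤ (Set.range b), ∀ x, g (x + l) = g x) :
    ∃ z, ∀ y, g y ≤ g z := by
  have hK : IsCompact (closure (ZSpan.fundamentalDomain b)) :=
    (ZSpan.fundamentalDomain_isBounded b).isCompact_closure
  obtain ⟨z, -, hz⟩ := hK.exists_isMaxOn
    ⟨ZSpan.fract b 0, subset_closure (ZSpan.fract_mem_fundamentalDomain b 0)⟩ hg.continuousOn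
  refine ⟨z, fun y => ?_⟩
  have h := hz (subset_closure (ZSpan.fract_mem_fundamentalDomain b y))
  have h2 := hper _ (ZSpan.floor b y).2 (ZSpan.fract b y)
  rw [ZSpan.fract_apply, sub_add_cancel] at h2
  rw [h2]
  exact h

end Max

end Vortex

end

theorem mainTheorem6 (m : ℕ) (hm : 0 < m) (lam₁ lam₂ : ℝ) (hlam₁ : 0 < lam₁)
    (hlam : lam₁ < lam₂) (A B C : ℂ) (hBC : ‖C‖ < ‖B‖)
    (hA : (m : ℝ) ^ 2 * ‖A‖ ^ 2 < 2 * (lam₂ / lam₁ - 1) * ‖C‖ ^ 2)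
    (N₁ N₂ : ℕ) (hN₁ : 0 < N₁) (p₁ : Fin N₁ → Vortex.Plane) (p₂ : Fin N₂ → Vortex.Plane)
    (u₁ u₂ : Vortex.Plane → ℝ) :
    ((∀ x, Vortex.vortexMult ⊥ p₂ x ≤ Vortex.vortexMult ⊥ p₁ x) →
      Vortex.IsPlanarSolution m lam₁ lam₂ A B C p₁ p₂ u₁ u₂ →
      ∀ x, x ∉ Vortex.vortexSet ⊥ p₁ ∪ Vortex.vortexSet ⊥ p₂ →
        u₁ x / lam₁ + u₂ x / lam₂ < 0 ∧ u₁ x / lam₁ - u₂ x / lam₂ < 0 ∧ u₁ x < 0) ∧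
    (∀ ω : Fin 2 → Vortex.Plane, LinearIndependent ℝ ω →
      (∀ x, Vortex.vortexMult (Vortex.periodLattice ω) p₂ x ≤
        Vortex.vortexMult (Vortex.periodLattice ω) p₁ x) →
      Vortex.IsPeriodicSolution ω m lam₁ lam₂ A B C p₁ p₂ u₁ u₂ →
      ∀ x, x ∉ Vortex.vortexSet (Vortex.periodLattice ω) p₁ ∪
          Vortex.vortexSet (Vortex.periodLattice ω) p₂ →
        u₁ x / lam₁ + u₂ x / lam₂ < 0 ∧ u₁ x / lam₁ - u₂ x / lam₂ < 0 ∧ u₁ x < 0) := by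
  open Vortex in
  constructor
  · intro hmult hsol x hx
    refine neg_of_isSolution hlam₁ hlam hBC hA hN₁ hmult hsol.isSolution rfl rfl ?_ hx
    have hu₁ := hsol.isSolution.eq₁.locallyIntegrable
    have hu₂ := hsol.isSolution.eq₂.locallyIntegrable
    refine exists_max_of_tendsto_zero ((hu₁.smul lam₁⁻¹).add (hu₂.smul lam₂⁻¹))
      ((hu₁.smul lam₁⁻¹).add (hu₂.smul (-lam₂⁻¹))) ?_ ?_
    · simpa using (hsol.tendsto₁.const_mul lam₁⁻¹).add (hsol.tendsto₂.const_mul lam₂⁻¹)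
    · simpa using (hsol.tendsto₁.const_mul lam₁⁻¹).add (hsol.tendsto₂.const_mul (-lam₂⁻¹))
  · intro ω hω hmult hsol x hx
    let b : Module.Basis (Fin 2) ℝ Plane :=
      basisOfLinearIndependentOfCardEqFinrank hω (by simp)
    have hb : periodLattice ω = (Submodule.span ℤ (Set.range b)).toAddSubgroup := by
      rw [Submodule.span_int_eq_addSubgroupClosure, periodLattice]
      simp [b]
    have hdisc : DiscreteTopology (periodLattice ω) := by
      rw [hb]; infer_instance
    refine neg_of_isSolution hlam₁ hlam hBC hA hN₁ hmult hsol.isSolution rfl rfl ?_ hx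
    intro ρ _ _
    have hu₁ := hsol.isSolution.eq₁.locallyIntegrable
    have hu₂ := hsol.isSolution.eq₂.locallyIntegrable
    refine exists_max_of_periodic b (((contDiff_mollify ((hu₁.smul lam₁⁻¹).add
      (hu₂.smul lam₂⁻¹)) ρ).continuous.max
      (contDiff_mollify ((hu₁.smul lam₁⁻¹).add (hu₂.smul (-lam₂⁻¹))) ρ).continuous)) ?_
    intro l hl y
    have hl' : l ∈ periodLattice ω := by rw [hb]; exact hl
    have hnull : ∀ᵐ t, t ∉ vortexSet (periodLattice ω) p₁ ∪ vortexSet (periodLattice ω) p₂ :=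
      ((countable_vortexSet p₁).union (countable_vortexSet p₂)).ae_notMem _
    have hper (c c' : ℝ) : mollify ρ (fun t => c * u₁ t + c' * u₂ t) (y + l) =
        mollify ρ (fun t => c * u₁ t + c' * u₂ t) y := by
      rw [mollify_add_right]
      refine mollify_congr_ae ?_ ρ y
      filter_upwards [hnull] with t ht
      rw [hsol.periodic₁ l hl' t ht, hsol.periodic₂ l hl' t ht]
    exact congrArg₂ max (hper _ _) (hper _ _)
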